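/- Let $\mathcal A$ be a finite alphabet, and let $X\subset\mathcal A^{\mathbb Z}$ be a transitive sofic shift with shift map $(\sigma x)_n=x_{n+1}$; write $\mathcal L(X)$ for its language and ${\rm Aut}(X)$ for the group of self-homeomorphisms of $X$ that commute with $\sigma$. Let $k\ge 1$. A point $x\in X$ is $k$-periodic if $k$ is the least positive integer with $x_n=x_{n-k}$ for all $n\in\mathbb Z$; the set of these points is ${\rm Per}_k$, and ${\rm Aut}(X)$ acts on the set of orbits ${\rm Per}_k/\langle\sigma\rangle$. A point $x\in X$ is left-$k$-periodic up to $N\in\mathbb Z$ if $k$ is the least positive integer such that $x_n=x_{n-k}$ for all $n<N$ and $x_N\ne x_{N-k}$. Let $Q_k$ be the set of points of $X$ that are left-$k$-periodic up to $k$. For $g\in{\rm Aut}(X)$ and $x\in Q_k$ there is a unique $\alpha(g,x)\in\mathbb Z$ with $\sigma^{\alpha(g,x)}(gx)\in Q_k$, and ${\rm Aut}(X)$ acts on $Q_k$ by $g\cdot x=\sigma^{\alpha(g,x)}(gx)$. A word $w\in\mathcal L(X)$ is synchronizing if $uwv\in\mathcal L(X)$ whenever $uw,wv\in\mathcal L(X)$,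 and a point of $X$ is synchronizing if all sufficiently long words occurring in it are synchronizing. Let ${\rm Syn}_k\subset{\rm Per}_k$ be the set of $k$-periodic points $x$ such that $hx$ is synchronizing for some $h\in{\rm Aut}(X)$ (possibly $h={\rm id}$). Suppose that $X$ contains a left-$k$-periodic point (up to some $N$). Fix $x^m\in{\rm Syn}_k$ and let $$\Omega^m=\{x\in Q_k:\ \exists\, i\in\mathbb Z\text{ with }x_n=x^m_{n-i}\text{ for all }n<k\}.$$ For $w\in\mathcal L(X)$ put $[w]^m=\{x\in\Omega^m:\ x_n=w_n\text{ for }0\le n<|w|\}$. Let $w,u\in\mathcal L(X)$ be words such that $[w]^m$ and $[u]^m$ are nonempty proper subsets of $\Omega^m$. Then there is an automorphism $g\in{\rm Aut}(X)$ which acts as the identity on ${\rm Per}_k/\langle\sigma\rangle$ and satisfies $g\cdot[w]^m\subset[u]^m$. -/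

import Mathlib

open SymbolicDynamics.FullShift
open scoped Pointwise

noncomputable section

namespace SymbolicDynamics.FullShift.Subshift

/-! ### Words, languages, transitive shifts, sofic shifts -/

section Words

variable {A : Type*}

/-- The word `w` occurs in the bi-infinite sequence `x` at position `i`. -/
def OccursAt (w : List A) (x : ℤ → A) (i : ℤ) : Prop :=
  ∀ (j : ℕ) (hj : j < w.length), x (i + j) = w[j]

variable [TopologicalSpace A] (X : Subshift A ℤ)

/-- The language of `X`: all finite words that occur in points of `X`. -/
def language : Set (List A) :=
  {w | ∃ x ∈ X.carrier, ∃ i : ℤ, OccursAt w x i}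

/-- `X` is transitive: any two allowable words `u`, `w` can be joined by some word `v`. -/
def IsTransitive : Prop :=
  ∀ u ∈ X.language, ∀ w ∈ X.language, ∃ v : List A, u ++ v ++ w ∈ X.language

/-- The word `w` is synchronizing for `X`. -/
def IsSynchronizingWord (w : List A) : Prop :=
  w ∈ X.language ∧
    ∀ u v : List A, u ++ w ∈ X.language → w ++ v ∈ X.language → u ++ w ++ v ∈ X.language

/-- `X` is a shift of finite type: it is described by a finite set of forbidden words. -/
def IsSFT : Prop :=
  ∃ F : Set (List A), F.Finite ∧
    ∀ x : ℤ → A, x ∈ X.carrier ↔ ∀ w ∈ F, ∀ i : ℤ, ¬ OccursAt w x i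

/-- The homeomorphism `σ ^ i` of `X`, given by `(σ ^ i x) n = x (i + n)`. -/
def sigma (i : ℤ) : X.carrier ≃ₜ X.carrier where
  toFun x := ⟨shift i x.1, X.mapsTo i x.2⟩
  invFun x := ⟨shift (-i) x.1, X.mapsTo (-i) x.2⟩
  left_inv x := by ext n; simp
  right_inv x := by ext n; simp
  continuous_toFun := by fun_prop
  continuous_invFun := by fun_prop

/-- `X` is sofic: it is a topological factor of a shift of finite type over a finite alphabet. -/
def IsSofic : Prop :=
  ∃ (b : ℕ) (Y : Subshift (Fin b) ℤ), Y.IsSFT ∧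
    ∃ π : Y.carrier → X.carrier, Continuous π ∧ Function.Surjective π ∧
      ∀ y, π (Y.sigma 1 y) = X.sigma 1 (π y)

/-- The automorphism group of `X`: self-homeomorphisms commuting with the shift map. -/
def Aut : Subgroup (X.carrier ≃ₜ X.carrier) :=
  Subgroup.centralizer {X.sigma 1}

end Words

/-! ### Periodic and left-periodic points -/

section Periodic

variable {A : Type*}

/-- `x` is `k`-periodic: `k` is the least positive integer with `x n = x (n - k)` for all `n`. -/
def IsPeriodic (x : ℤ → A) (k : ℕ) : Prop :=
  IsLeast {j : ℕ | 0 < j ∧ ∀ n : ℤ, x n = x (n - j)} k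

/-- `x` is left-`k`-periodic up to `N`: `k` is the least positive integer such that
`x n = x (n - k)` for all `n < N` and `x N ≠ x (N - k)`. -/
def IsLeftPeriodicUpTo (x : ℤ → A) (k : ℕ) (N : ℤ) : Prop :=
  IsLeast {j : ℕ | 0 < j ∧ (∀ n < N, x n = x (n - j)) ∧ x N ≠ x (N - j)} k

/-- The point `x` is left-`k`-periodic (up to some index). -/
def IsLeftPeriodic (x : ℤ → A) (k : ℕ) : Prop :=
  ∃ N : ℤ, IsLeftPeriodicUpTo x k N

variable [TopologicalSpace A] (X : Subshift A ℤ)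

/-- The set `Per_k` of `k`-periodic points of `X`. -/
def Per (k : ℕ) : Set X.carrier := {x | IsPeriodic x.1 k}

/-- The set `Q_k` of left-`k`-periodic points of `X` up to `k`. -/
def Q (k : ℕ) : Set X.carrier := {x | IsLeftPeriodicUpTo x.1 k k}

/-- The point `x` of `X` is synchronizing: all sufficiently long words occurring in `x` are
synchronizing. -/
def IsSynchronizing (x : X.carrier) : Prop :=
  ∃ c : ℕ, ∀ w : List A, c ≤ w.length → (∃ i : ℤ, OccursAt w x.1 i) → X.IsSynchronizingWord w

/-- The set `Syn_k` of `k`-periodic points which are synchronizing, or are mapped to a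
synchronizing point by some automorphism. -/
def Syn (k : ℕ) : Set X.carrier :=
  {x | x ∈ X.Per k ∧ (X.IsSynchronizing x ∨ ∃ h : X.Aut, X.IsSynchronizing (h.1 x))}

end Periodic

/-! ### Elementary facts on shifts and automorphisms -/

section Facts

variable {A : Type*} [TopologicalSpace A] (X : Subshift A ℤ)

@[simp] lemma sigma_apply (i : ℤ) (x : X.carrier) (n : ℤ) :
    (X.sigma i x).1 n = x.1 (i + n) := rfl

lemma sigma_add (i j : ℤ) (x : X.carrier) : X.sigma (i + j) x = X.sigma i (X.sigma j x) := by
  ext n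
  simp only [sigma_apply]
  exact congrArg x.1 (by ring)

lemma sigma_zero (x : X.carrier) : X.sigma 0 x = x := by
  ext n; simp

variable {X} in
lemma Aut.sigma_one (g : X.Aut) (x : X.carrier) : g.1 (X.sigma 1 x) = X.sigma 1 (g.1 x) := by
  have h := Subgroup.mem_centralizer_singleton_iff.mp g.2
  exact congrArg (fun f : X.carrier ≃ₜ X.carrier => f x) h

variable {X} in
/-- Automorphisms commute with all powers of the shift. -/
lemma Aut.sigma_comm (g : X.Aut) (i : ℤ) (x : X.carrier) :
    g.1 (X.sigma i x) = X.sigma i (g.1 x) := by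
  induction i using Int.induction_on with
  | zero => simp only [sigma_zero]
  | succ i ih =>
    rw [add_comm, sigma_add, Aut.sigma_one, ih, ← sigma_add]
  | pred i ih =>
    apply (X.sigma 1).injective
    rw [← Aut.sigma_one, ← sigma_add, ← sigma_add]
    have e : (1 : ℤ) + (-(i : ℤ) - 1) = -i := by ring
    rw [e, ih]

variable {X} in
lemma Aut.mul_apply (g h : X.Aut) (x : X.carrier) : (g * h).1 x = g.1 (h.1 x) := rfl

variable {X} in
lemma Aut.inv_apply_self (g : X.Aut) (x : X.carrier) : (g⁻¹).1 (g.1 x) = x :=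
  g.1.symm_apply_apply x

end Facts

/-! ### The action on periodic orbits -/

section PerOrbits

variable {A : Type*} [TopologicalSpace A] (X : Subshift A ℤ)

lemma periodic_iff_sigma (x : X.carrier) (j : ℕ) :
    (∀ n : ℤ, x.1 n = x.1 (n - j)) ↔ X.sigma (-j) x = x := by
  constructor
  · intro h
    ext n
    rw [sigma_apply, h n]
    exact congrArg x.1 (by ring)
  · intro h n
    conv_lhs => rw [← h]
    rw [sigma_apply]
    exact congrArg x.1 (by ring)

variable {X} in
/-- `Per_k` is invariant under automorphisms. -/
lemma Aut.mem_Per (g : X.Aut) {k : ℕ} {x : X.carrier} (hx : x ∈ X.Per k) : g.1 x ∈ X.Per k := by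
  have e : {j : ℕ | 0 < j ∧ ∀ n : ℤ, (g.1 x).1 n = (g.1 x).1 (n - j)} =
      {j : ℕ | 0 < j ∧ ∀ n : ℤ, x.1 n = x.1 (n - j)} := by
    ext j
    simp only [Set.mem_ofPred_eq, periodic_iff_sigma, ← Aut.sigma_comm, g.1.injective.eq_iff]
  change IsLeast _ k
  rw [e]
  exact hx

/-- Two points of `Per_k` are equivalent when they lie in the same `σ`-orbit. -/
def perSetoid (k : ℕ) : Setoid (X.Per k) where
  r x y := ∃ i : ℤ, X.sigma i x.1 = y.1
  iseqv :=
    { refl := fun x => ⟨0, X.sigma_zero x.1⟩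
      symm := by
        rintro x y ⟨i, h⟩
        exact ⟨-i, by rw [← h, ← sigma_add, neg_add_cancel, sigma_zero]⟩
      trans := by
        rintro x y z ⟨i, h⟩ ⟨j, h'⟩
        exact ⟨j + i, by rw [sigma_add, h, h']⟩ }

/-- The set `Per_k / ⟨σ⟩` of `σ`-orbits of `k`-periodic points. -/
def PerOrbits (k : ℕ) : Type _ := Quotient (X.perSetoid k)

/-- The action of the automorphism group on `Per_k / ⟨σ⟩`, induced by its action on `X`. -/
instance perOrbitsAction (k : ℕ) : MulAction X.Aut (X.PerOrbits k) where
  smul g := Quotient.map (fun x : X.Per k => (⟨g.1 x.1, Aut.mem_Per g x.2⟩ : X.Per k)) (by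
    rintro x y ⟨i, h⟩
    exact ⟨i, by rw [← Aut.sigma_comm, h]⟩)
  one_smul c := Quotient.inductionOn c fun _ => rfl
  mul_smul _ _ c := Quotient.inductionOn c fun _ => rfl

end PerOrbits

/-! ### The action on `Q_k` -/

section LeftPeriodic

variable {A : Type*}

/-- A point whose left tail is `k`-periodic, but which is not `σ ^ k`-invariant, satisfies the
period `k` exactly up to a unique index. -/
lemma exists_break {x : ℤ → A} {k : ℕ} (h1 : ∃ M : ℤ, ∀ n < M, x n = x (n - k))
    (h2 : ¬ ∀ n : ℤ, x n = x (n - k)) :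
    ∃ N : ℤ, (∀ n < N, x n = x (n - k)) ∧ x N ≠ x (N - k) := by
  obtain ⟨M, hM⟩ := h1
  push Not at h2
  obtain ⟨N, hN, hmin⟩ := Int.exists_least_of_bdd (P := fun n => x n ≠ x (n - k))
    ⟨M, fun z hz => by
      by_contra hlt
      exact hz (hM z (not_le.mp hlt))⟩ h2
  refine ⟨N, fun n hn => ?_, hN⟩
  by_contra hne
  exact absurd (hmin n hne) (not_le.mpr hn)

lemma sub_mul_of_period {x : ℤ → A} {k : ℕ} {N : ℤ} (h : ∀ n < N, x n = x (n - k)) (t : ℕ) :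
    ∀ n < N, x n = x (n - t * k) := by
  induction t with
  | zero => intro n _; simp
  | succ t ih =>
    intro n hn
    have hk : (0 : ℤ) ≤ (t : ℤ) * k := by positivity
    rw [ih n hn, h (n - t * k) (by linarith)]
    congr 1
    push_cast
    ring

/-- A period of the left tail persists as long as any other period does, and breaks at the same
index. -/
lemma tail_period_extends {x : ℤ → A} {j k : ℕ} {M N : ℤ} (hj : 0 < j) (hk : 0 < k)
    (h1 : ∀ n < N, x n = x (n - k)) (h2 : x N ≠ x (N - k)) (h3 : ∀ n < M, x n = x (n - j)) :
    (∀ n < N, x n = x (n - j)) ∧ x N ≠ x (N - j) := by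
  have key : ∀ n < N, x n = x (n - j) := by
    intro n hn
    obtain ⟨t, ht⟩ : ∃ t : ℕ, n - t * k < M := by
      refine ⟨(n - M).toNat + 1, ?_⟩
      have h4 := Int.self_le_toNat (n - M)
      have h5 : (1 : ℤ) ≤ k := by exact_mod_cast hk
      push_cast
      nlinarith
    rw [sub_mul_of_period h1 t n hn, h3 _ ht, sub_mul_of_period h1 t (n - j) (by omega)]
    congr 1
    ring
  refine ⟨key, fun e => h2 ?_⟩
  rw [e, h1 (N - j) (by omega), key (N - k) (by omega)]
  congr 1
  ring

lemma isLeftPeriodicUpTo_unique {x : ℤ → A} {k : ℕ} {M N : ℤ} (h : IsLeftPeriodicUpTo x k M)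
    (h' : IsLeftPeriodicUpTo x k N) : M = N := by
  rcases lt_trichotomy M N with hlt | heq | hlt
  · exact absurd (h'.1.2.1 M hlt) h.1.2.2
  · exact heq
  · exact absurd (h.1.2.1 N hlt) h'.1.2.2

variable [TopologicalSpace A] {X : Subshift A ℤ}

lemma isLeftPeriodicUpTo_sigma_iff (x : X.carrier) (k : ℕ) (i N : ℤ) :
    IsLeftPeriodicUpTo (X.sigma i x).1 k N ↔ IsLeftPeriodicUpTo x.1 k (i + N) := by
  have e : {j : ℕ | 0 < j ∧ (∀ n < N, (X.sigma i x).1 n = (X.sigma i x).1 (n - j)) ∧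
        (X.sigma i x).1 N ≠ (X.sigma i x).1 (N - j)} =
      {j : ℕ | 0 < j ∧ (∀ n < i + N, x.1 n = x.1 (n - j)) ∧ x.1 (i + N) ≠ x.1 (i + N - j)} := by
    ext j
    simp only [Set.mem_ofPred_eq, sigma_apply]
    refine and_congr_right fun _ => and_congr ⟨fun h n hn => ?_, fun h n hn => ?_⟩ ?_
    · have := h (n - i) (by omega)
      rw [show i + (n - i) = n by ring, show i + (n - i - j) = n - j by ring] at this
      exact this
    · rw [h (i + n) (by omega)]
      exact congrArg x.1 (by ring)
    · rw [add_sub_assoc]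
  rw [IsLeftPeriodicUpTo, e]
  rfl

variable [Finite A] [DiscreteTopology A]

/-- Automorphisms preserve the relation of agreeing on a left tail. -/
lemma Aut.left_tail (g : X.Aut) {x y : X.carrier} {N : ℤ} (h : ∀ n < N, x.1 n = y.1 n) :
    ∃ M : ℤ, ∀ n < M, (g.1 x).1 n = (g.1 y).1 n := by
  have : CompactSpace X.carrier := isCompact_iff_compactSpace.mp X.isClosed.isCompact
  by_contra hcon
  push Not at hcon
  have hfreq : ∃ᶠ n : ℤ in Filter.atBot, (g.1 x).1 n ≠ (g.1 y).1 n := by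
    rw [Filter.frequently_atBot]
    intro a
    obtain ⟨b, hb, hne⟩ := hcon a
    exact ⟨b, hb.le, hne⟩
  have : (Filter.atBot ⊓ Filter.principal {n : ℤ | (g.1 x).1 n ≠ (g.1 y).1 n}).NeBot :=
    Filter.frequently_mem_iff_neBot.mp hfreq
  obtain ⟨U, hU⟩ := Ultrafilter.exists_le
    (Filter.atBot ⊓ Filter.principal {n : ℤ | (g.1 x).1 n ≠ (g.1 y).1 n})
  have hbot : (U : Filter ℤ) ≤ Filter.atBot := hU.trans inf_le_left
  have hne : ∀ᶠ n in (U : Filter ℤ), (g.1 x).1 n ≠ (g.1 y).1 n :=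
    (hU.trans inf_le_right) (Filter.mem_principal_self _)
  have lim : ∀ z : X.carrier, ∃ p : X.carrier,
      Filter.Tendsto (fun n => X.sigma n z) (U : Filter ℤ) (nhds p) := fun z => by
    obtain ⟨p, -, hp⟩ := isCompact_univ.ultrafilter_le_nhds (U.map (fun n => X.sigma n z))
      (by simp)
    exact ⟨p, hp⟩
  obtain ⟨p, hp⟩ := lim x
  obtain ⟨q, hq⟩ := lim y
  have coord : ∀ (z p : X.carrier), Filter.Tendsto (fun n => X.sigma n z) (U : Filter ℤ) (nhds p) →
      ∀ m : ℤ, ∀ᶠ n in (U : Filter ℤ), z.1 (n + m) = p.1 m := by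
    intro z p hz m
    have hc : Continuous fun s : X.carrier => s.1 m :=
      (continuous_apply m).comp continuous_subtype_val
    have := (hc.tendsto p).comp hz
    rw [nhds_discrete, Filter.tendsto_pure] at this
    exact this
  have hpq : p = q := by
    ext m
    have h1 : ∀ᶠ n in (U : Filter ℤ), n < N - m := hbot (Filter.eventually_lt_atBot _)
    obtain ⟨n, h2, h3, h4⟩ := (h1.and ((coord x p hp m).and (coord y q hq m))).exists
    rw [← h3, ← h4]
    exact h _ (by omega)
  have image : ∀ (z p : X.carrier), Filter.Tendsto (fun n => X.sigma n z) (U : Filter ℤ) (nhds p) →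
      Filter.Tendsto (fun n => X.sigma n (g.1 z)) (U : Filter ℤ) (nhds (g.1 p)) := by
    intro z p hz
    have := (g.1.continuous.tendsto p).comp hz
    simpa only [Function.comp_def, Aut.sigma_comm] using this
  obtain ⟨n, h1, h2, h3⟩ := (hne.and ((coord _ _ (image x p hp) 0).and
    (coord _ _ (image y q hq) 0))).exists
  rw [add_zero] at h2 h3
  exact h1 (by rw [h2, h3, hpq])

lemma Aut.tail_period (g : X.Aut) {x : X.carrier} {j : ℕ}
    (h : ∃ M : ℤ, ∀ n < M, x.1 n = x.1 (n - j)) :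
    ∃ M : ℤ, ∀ n < M, (g.1 x).1 n = (g.1 x).1 (n - j) := by
  obtain ⟨M, hM⟩ := h
  obtain ⟨M', hM'⟩ := Aut.left_tail g (x := x) (y := X.sigma (-j) x) (N := M) (fun n hn => by
    rw [hM n hn, sigma_apply]; exact congrArg x.1 (by ring))
  refine ⟨M', fun n hn => ?_⟩
  rw [hM' n hn, Aut.sigma_comm, sigma_apply]
  exact congrArg (g.1 x).1 (by ring)

/-- Automorphisms preserve left-`k`-periodicity. -/
lemma Aut.isLeftPeriodic (g : X.Aut) {x : X.carrier} {k : ℕ} (hx : IsLeftPeriodic x.1 k) :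
    IsLeftPeriodic (g.1 x).1 k := by
  obtain ⟨N, ⟨hk, hper, hbr⟩, hmin⟩ := hx
  obtain ⟨N', hper', hbr'⟩ := exists_break (Aut.tail_period g ⟨N, hper⟩) (by
    intro hall
    rw [periodic_iff_sigma, ← Aut.sigma_comm, g.1.injective.eq_iff, ← periodic_iff_sigma] at hall
    exact hbr (hall N))
  refine ⟨N', ⟨hk, hper', hbr'⟩, ?_⟩
  rintro j ⟨hj, hjper, -⟩
  obtain ⟨M, hM⟩ := Aut.tail_period g⁻¹ ⟨N', hjper⟩
  rw [Aut.inv_apply_self] at hM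
  exact hmin ⟨hj, tail_period_extends hj hk hper hbr hM⟩

/-- For `x` in `Q_k`, exactly one shift of `g x` lies in `Q_k`. -/
lemma Aut.existsUnique_shift (g : X.Aut) {k : ℕ} (x : X.Q k) :
    ∃! i : ℤ, X.sigma i (g.1 x.1) ∈ X.Q k := by
  obtain ⟨N, hN⟩ := Aut.isLeftPeriodic g (x := x.1) (k := k) ⟨k, x.2⟩
  refine ⟨N - k, ?_, fun i hi => ?_⟩
  · change IsLeftPeriodicUpTo _ _ _
    rw [isLeftPeriodicUpTo_sigma_iff]
    simpa using hN
  · have hi' : IsLeftPeriodicUpTo _ _ _ := hi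
    rw [isLeftPeriodicUpTo_sigma_iff] at hi'
    have := isLeftPeriodicUpTo_unique hi' hN
    omega

/-- The cocycle `α(g, x)`: the unique integer `i` such that `σ ^ i (g x)` lies in `Q_k`. -/
def cocycle {k : ℕ} (g : X.Aut) (x : X.Q k) : ℤ := (Aut.existsUnique_shift g x).choose

lemma cocycle_spec {k : ℕ} (g : X.Aut) (x : X.Q k) :
    X.sigma (cocycle g x) (g.1 x.1) ∈ X.Q k := (Aut.existsUnique_shift g x).choose_spec.1

lemma cocycle_unique {k : ℕ} (g : X.Aut) (x : X.Q k) {i : ℤ}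
    (hi : X.sigma i (g.1 x.1) ∈ X.Q k) : i = cocycle g x :=
  (Aut.existsUnique_shift g x).choose_spec.2 i hi

/-- The action of the automorphism group on `Q_k`: `g • x = σ ^ α(g, x) (g x)`. -/
instance qAction (k : ℕ) : MulAction X.Aut (X.Q k) where
  smul g x := ⟨X.sigma (cocycle g x) (g.1 x.1), cocycle_spec g x⟩
  one_smul x := by
    have h : (0 : ℤ) = cocycle 1 x :=
      cocycle_unique 1 x (by rw [sigma_zero]; exact x.2)
    apply Subtype.ext
    change X.sigma (cocycle 1 x) x.1 = x.1
    rw [← h, sigma_zero]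
  mul_smul g h x := by
    apply Subtype.ext
    set y : X.Q k := ⟨X.sigma (cocycle h x) (h.1 x.1), cocycle_spec h x⟩ with hy
    change X.sigma (cocycle (g * h) x) ((g * h).1 x.1) = X.sigma (cocycle g y) (g.1 y.1)
    have e : X.sigma (cocycle g y) (g.1 y.1) =
        X.sigma (cocycle g y + cocycle h x) ((g * h).1 x.1) := by
      rw [sigma_add, Aut.mul_apply, ← Aut.sigma_comm g (cocycle h x)]
    have hu : cocycle g y + cocycle h x = cocycle (g * h) x :=
      cocycle_unique (g * h) x (by rw [← e]; exact cocycle_spec g y)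
    rw [e, hu]

end LeftPeriodic

/-! ### The fibers over periodic orbits and their cylinder sets -/

section Fibers

variable {A : Type*} [TopologicalSpace A] (X : Subshift A ℤ)

/-- The fiber `Ω^m` of `Q_k` over the orbit of the periodic point `x`: the points of `Q_k` that
agree with some shift of `x` at all `n < k`. -/
def fiber (k : ℕ) (x : X.carrier) : Set (X.Q k) :=
  {y | ∃ i : ℤ, ∀ n < (k : ℤ), y.1.1 n = x.1 (n - i)}

/-- The cylinder set `[w]^m = [w] ∩ Ω^m` in the fiber over the orbit of `x`. -/
def fiberCylinder (k : ℕ) (x : X.carrier) (w : List A) : Set (X.Q k) :=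
  {y | OccursAt w y.1.1 0} ∩ X.fiber k x

end Fibers

end SymbolicDynamics.FullShift.Subshift

end

/-! The action over a synchronizing periodic orbit is extremely proximal, because left-periodic
points can be edited just before their break. Let `p` be a synchronizing `k`-periodic point and `z`
a point of the fiber that equals `p` left of `k`. Transitivity and gluing along words of `p` give a
point `R` of `X` that agrees with `z` up to `n₀` and later returns to `p` in phase
(`exists_homoclinic`).

Consider the involution that exchanges the excursion `R` with a stretch of `p` of the same length,
wherever this block follows a long run of `p`, is followed by a further piece of `p`, and that piece
soon breaks in a way unlike the beginning of `z`. These conditions make occurrences independent of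
each other (`excursionRule`), so the exchange is an automorphism (`SwapRule.exists_aut`). Every
occurrence needs a break of the period, so points of period `k` are fixed. If `q` in the fiber
differs from `z` on `[0, n₀)`, an excursion is inserted before its break; the new first break is
that of `R`, and after recentring the image agrees with `z` up to `n₀` (`exists_contraction`).

Thus the complement of a small neighbourhood of `z` moves into that neighbourhood, and a second such
map carries it on to a point `y` (`exists_compression`). With `z` outside `[w]` and `y` in `[u]`
this is the claim for a synchronizing point. If only an image under some automorphism `h` is
synchronizing, conjugation by `h` transports the result. -/

namespace SymbolicDynamics.FullShift.Subshift

/-! ### Gluing along synchronizing words and homoclinic excursions -/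

section Gluing

variable {A : Type*}

/-- The word of length `l` read in `x` from position `i` on. -/
def wordAt (x : ℤ → A) (i : ℤ) (l : ℕ) : List A := List.ofFn fun m : Fin l => x (i + (m : ℕ))

@[simp] lemma length_wordAt (x : ℤ → A) (i : ℤ) (l : ℕ) : (wordAt x i l).length = l := by
  simp [wordAt]

lemma occursAt_wordAt_iff (x y : ℤ → A) (i t : ℤ) (l : ℕ) :
    OccursAt (wordAt x i l) y t ↔ ∀ j : ℕ, j < l → y (t + j) = x (i + j) := by
  simp [OccursAt, wordAt]

lemma wordAt_congr {x y : ℤ → A} {i t : ℤ} {l : ℕ}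
    (h : ∀ j : ℕ, j < l → x (i + j) = y (t + j)) : wordAt x i l = wordAt y t l := by
  unfold wordAt
  congr 1
  funext m
  exact h m m.2

lemma wordAt_append (x : ℤ → A) (i : ℤ) (l m : ℕ) :
    wordAt x i l ++ wordAt x (i + l) m = wordAt x i (l + m) := by
  apply List.ext_getElem
  · simp
  · intro n h1 h2
    rw [List.getElem_append]
    split_ifs with h
    · simp [wordAt]
    · simp only [wordAt, List.getElem_ofFn, List.length_ofFn]
      simp only [length_wordAt, not_lt] at h
      congr 1
      push_cast [h]
      ring

lemma OccursAt.append_iff {u v : List A} {x : ℤ → A} {i : ℤ} :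
    OccursAt (u ++ v) x i ↔ OccursAt u x i ∧ OccursAt v x (i + u.length) := by
  constructor
  · intro h
    refine ⟨fun j hj => ?_, fun j hj => ?_⟩
    · rw [h j (by simp; omega), List.getElem_append_left hj]
    · have := h (u.length + j) (by simp; omega)
      rw [List.getElem_append_right (by omega)] at this
      simp only [add_tsub_cancel_left] at this
      rw [← this]
      congr 1
      push_cast
      ring
  · rintro ⟨h1, h2⟩ j hj
    rw [List.getElem_append]
    split_ifs with h
    · exact h1 j h
    · have := h2 (j - u.length) (by simp at hj; omega)
      rw [← this]
      congr 1
      push_cast [not_lt.mp h]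
      ring

lemma add_mul_period {p : ℤ → A} {k : ℕ} (hp : ∀ n, p n = p (n - k)) (n t : ℤ) :
    p (n + t * k) = p n := by
  induction t using Int.induction_on with
  | zero => simp
  | succ t ih =>
    rw [← ih, hp]
    exact congrArg p (by ring)
  | pred t ih =>
    rw [← ih, hp (n + -(t : ℤ) * k)]
    exact congrArg p (by ring)

lemma eq_of_dvd_sub {p : ℤ → A} {k : ℕ} (hp : ∀ n, p n = p (n - k)) {m n : ℤ}
    (h : (k : ℤ) ∣ m - n) : p m = p n := by
  obtain ⟨t, ht⟩ := h
  rw [← add_mul_period hp n t]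
  exact congrArg p (by linarith)

variable [TopologicalSpace A] {X : Subshift A ℤ}

lemma shift_mem {x : ℤ → A} (hx : x ∈ X.carrier) (t : ℤ) : (fun n => x (t + n)) ∈ X.carrier :=
  X.mapsTo t hx

lemma shift_mem' {x : ℤ → A} (hx : x ∈ X.carrier) (t : ℤ) : (fun n => x (n - t)) ∈ X.carrier := by
  have := shift_mem hx (-t)
  convert this using 3
  ring

lemma wordAt_mem_language_iff (q : ℤ → A) (i : ℤ) (l : ℕ) :
    wordAt q i l ∈ X.language ↔
      ∃ y ∈ X.carrier, ∀ n, i ≤ n → n < i + l → y n = q n := by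
  constructor
  · rintro ⟨y, hy, t, ht⟩
    refine ⟨_, shift_mem hy (t - i), fun n h1 h2 => ?_⟩
    rw [occursAt_wordAt_iff] at ht
    have := ht (n - i).toNat (by omega)
    rw [Int.toNat_of_nonneg (by omega)] at this
    rw [show i + (n - i) = n by ring] at this
    rw [← this]
    exact congrArg y (by ring)
  · rintro ⟨y, hy, h⟩
    refine ⟨y, hy, i, ?_⟩
    rw [occursAt_wordAt_iff]
    intro j hj
    exact h _ (by omega) (by omega)

lemma mem_of_forall_window {q : ℤ → A}
    (h : ∀ N : ℕ, ∃ y ∈ X.carrier, ∀ n : ℤ, -N ≤ n → n < N → y n = q n) : q ∈ X.carrier := by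
  rw [← X.isClosed.closure_eq, mem_closure_iff]
  intro o ho hq
  obtain ⟨I, u, hu, hsub⟩ := isOpen_pi_iff.mp ho q hq
  obtain ⟨y, hy, hyq⟩ := h (I.sup Int.natAbs + 1)
  refine ⟨y, hsub fun n hn => ?_, hy⟩
  have : n.natAbs ≤ I.sup Int.natAbs := Finset.le_sup (f := Int.natAbs) hn
  rw [hyq n (by omega) (by omega)]
  exact (hu n hn).2

/-- Two points of `X` can be glued along a synchronizing word. -/
lemma glue {a b q : ℤ → A} (ha : a ∈ X.carrier) (hb : b ∈ X.carrier) {i : ℤ} {l : ℕ}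
    (hqa : ∀ n < i + l, q n = a n) (hqb : ∀ n, i ≤ n → q n = b n)
    (hs : X.IsSynchronizingWord (wordAt q i l)) : q ∈ X.carrier := by
  apply mem_of_forall_window
  intro N
  obtain ⟨s, hs1, hs2⟩ : ∃ s : ℕ, i - s ≤ -N ∧ N ≤ i + l + s :=
    ⟨N + i.natAbs + l, by omega, by omega⟩
  have h1 : wordAt q (i - s) s ++ wordAt q i l = wordAt q (i - s) (s + l) := by
    rw [← wordAt_append]
    congr 2
    ring
  have h2 : wordAt q (i - s) (s + l) ++ wordAt q (i + l) s = wordAt q (i - s) (s + l + s) := by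
    rw [← wordAt_append q (i - s) (s + l)]
    congr 2
    push_cast
    ring
  have h3 := hs.2 (wordAt q (i - s) s) (wordAt q (i + l) s) (by
      rw [h1, wordAt_mem_language_iff]
      exact ⟨a, ha, fun n _ hn => (hqa n (by push_cast at hn; omega)).symm⟩) (by
      rw [wordAt_append, wordAt_mem_language_iff]
      exact ⟨b, hb, fun n hn _ => (hqb n hn).symm⟩)
  rw [h1, h2, wordAt_mem_language_iff] at h3
  obtain ⟨y, hy, h⟩ := h3
  exact ⟨y, hy, fun n hn hn' => h n (by omega) (by push_cast; omega)⟩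

/-- Two points of `X` can be glued along a long word of a synchronizing periodic point. -/
lemma glue_periodic {p a b q : ℤ → A} {c : ℕ}
    (hc : ∀ i, X.IsSynchronizingWord (wordAt p i c))
    (ha : a ∈ X.carrier) (hb : b ∈ X.carrier) (i t : ℤ)
    (hqa : ∀ n < i + c, q n = a n) (hqb : ∀ n, i ≤ n → q n = b n)
    (hqp : ∀ n, i ≤ n → n < i + c → q n = p (n - t)) : q ∈ X.carrier := by
  refine glue ha hb hqa hqb ?_
  rw [show wordAt q i c = wordAt p (i - t) c from wordAt_congr fun j hj => by
    rw [hqp _ (by omega) (by omega)]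
    exact congrArg p (by ring)]
  exact hc _

/-- An excursion away from a synchronizing periodic point with prescribed beginning. -/
lemma exists_excursion (htrans : X.IsTransitive) {p z : ℤ → A} {c k : ℕ}
    (hpX : p ∈ X.carrier) (hc : ∀ i, X.IsSynchronizingWord (wordAt p i c))
    (hz : z ∈ X.carrier) (hzp : ∀ n < (k : ℤ), z n = p n) (n₀ : ℕ) (hn₀ : k ≤ n₀) :
    ∃ B : ℕ, n₀ ≤ B ∧ ∃ R ∈ X.carrier, (∀ n < (n₀ : ℤ), R n = z n) ∧
      ∀ n, (B : ℤ) ≤ n → R n = p (n - B) := by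
  obtain ⟨v, r₀, hr₀, t, ht⟩ := htrans (wordAt z (k - c) (c + n₀ - k))
    ((wordAt_mem_language_iff _ _ _).2 ⟨z, hz, fun _ _ _ => rfl⟩) (wordAt p 0 c)
    ((wordAt_mem_language_iff _ _ _).2 ⟨p, hpX, fun _ _ _ => rfl⟩)
  rw [OccursAt.append_iff, OccursAt.append_iff, occursAt_wordAt_iff, occursAt_wordAt_iff] at ht
  obtain ⟨⟨h1, -⟩, h2⟩ := ht
  set B : ℕ := n₀ + v.length with hB
  set r : ℤ → A := fun n => r₀ (t - (k - c) + n) with hr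
  have hrX : r ∈ X.carrier := shift_mem hr₀ _
  have hr1 : ∀ n : ℤ, k - c ≤ n → n < n₀ → r n = z n := by
    intro n hn hn'
    have := h1 (n - (k - c)).toNat (by omega)
    rw [Int.toNat_of_nonneg (by omega)] at this
    rw [show (k : ℤ) - c + (n - (k - c)) = n by ring] at this
    rw [← this]
    exact congrArg r₀ (by ring)
  have hr2 : ∀ n : ℤ, B ≤ n → n < B + c → r n = p (n - B) := by
    intro n hn hn'
    have := h2 (n - B).toNat (by omega)
    rw [Int.toNat_of_nonneg (by omega), zero_add] at this
    rw [← this]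
    refine congrArg r₀ ?_
    simp only [List.length_append, length_wordAt]
    omega
  -- The word found by transitivity starts with `c` letters of the run of `p` in `z` and ends with
  -- `c` letters of `p`; these two synchronizing words allow gluing on the tail of `z` and then a
  -- tail of `p`.
  have hs : (fun n => if n < (k : ℤ) then z n else r n) ∈ X.carrier := by
    refine glue_periodic hc hz hrX (k - c) 0 ?_ ?_ ?_
    · intro n hn
      rw [if_pos (by omega)]
    · intro n hn
      split_ifs with h
      · exact (hr1 n hn (by omega)).symm
      · rfl
    · intro n hn hn'
      rw [if_pos (by omega), sub_zero]
      exact hzp n (by omega)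
  refine ⟨B, by omega, fun n => if n < (B : ℤ) then (if n < (k : ℤ) then z n else r n)
    else p (n - B), ?_, ?_, ?_⟩
  · refine glue_periodic hc hs (shift_mem' hpX B) B B ?_ ?_ ?_
    · intro n hn
      split_ifs with h h' h' <;> first | rfl | omega | exact (hr2 n (by omega) (by omega)).symm
    · intro n hn
      rw [if_neg (by omega)]
    · intro n hn hn'
      rw [if_neg (by omega)]
  · intro n hn
    beta_reduce
    rw [if_pos (by omega)]
    split_ifs with h
    · rfl
    · exact hr1 n (by omega) hn
  · intro n hn
    beta_reduce
    rw [if_neg (by omega)]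

/-- An excursion away from a synchronizing periodic point `p` with prescribed beginning, which
returns to `p` in phase. -/
lemma exists_homoclinic (htrans : X.IsTransitive) {p z : ℤ → A} {c k : ℕ} (hk : 0 < k)
    (hpX : p ∈ X.carrier) (hp : ∀ n, p n = p (n - k))
    (hc : ∀ i, X.IsSynchronizingWord (wordAt p i c))
    (hz : z ∈ X.carrier) (hzp : ∀ n < (k : ℤ), z n = p n) (n₀ : ℕ) (hn₀ : k ≤ n₀) :
    ∃ B : ℕ, n₀ ≤ B ∧ ∃ R ∈ X.carrier, (∀ n < (n₀ : ℤ), R n = z n) ∧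
      ∀ n, (B : ℤ) ≤ n → R n = p n := by
  obtain ⟨B₀, hB₀, R₀, hR₀, hR₀z, hR₀p⟩ := exists_excursion htrans hpX hc hz hzp n₀ hn₀
  -- One excursion shifts the phase of `p` by `B₀`. Chaining `k` of them shifts it by `k * B₀`,
  -- which is a multiple of the period.
  have key : ∀ t : ℕ, ∃ B : ℕ, n₀ ≤ B ∧ ∃ R ∈ X.carrier, (∀ n < (n₀ : ℤ), R n = z n) ∧
      ∀ n, (B : ℤ) ≤ n → R n = p (n - (t + 1) * B₀) := by
    intro t
    induction t with
    | zero => exact ⟨B₀, hB₀, R₀, hR₀, hR₀z, by simpa using hR₀p⟩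
    | succ t ih =>
      obtain ⟨B, hB, R, hR, hRz, hRp⟩ := ih
      -- `S` is where the next excursion starts: in phase with the current tail, and late enough
      -- that `c` letters of `p` precede it.
      obtain ⟨S, hSB, hSk⟩ : ∃ S : ℕ, B + c ≤ S ∧ (k : ℤ) ∣ S - (t + 1) * B₀ := by
        refine ⟨(t + 1) * B₀ + (B + c) * k, ?_, ?_⟩
        · have : (B + c) * 1 ≤ (B + c) * k := Nat.mul_le_mul_left _ hk
          have := Nat.zero_le ((t + 1) * B₀)
          omega
        · push_cast
          ring_nf
          exact dvd_add (Dvd.intro_left _ rfl) (Dvd.intro_left _ rfl)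
      have hSp : ∀ n, p (n - (t + 1) * B₀) = p (n - S) := fun n =>
        eq_of_dvd_sub hp (by
          have : n - (t + 1) * B₀ - (n - S) = (S : ℤ) - (t + 1) * B₀ := by ring
          rwa [this])
      refine ⟨S + B₀, by omega, fun n => if n < (S : ℤ) + k then R n else R₀ (n - S), ?_, ?_, ?_⟩
      · refine glue_periodic hc hR (shift_mem' hR₀ S) (S + k - c) S ?_ ?_ ?_
        · intro n hn
          rw [if_pos (by omega)]
        · intro n hn
          split_ifs with h
          · rw [hRp n (by omega), hR₀z _ (by omega), hzp _ (by omega), hSp]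
          · rfl
        · intro n hn hn'
          rw [if_pos (by omega), hRp n (by omega), hSp]
      · intro n hn
        beta_reduce
        rw [if_pos (by omega)]
        exact hRz n hn
      · intro n hn
        push_cast at hn
        beta_reduce
        rw [if_neg (by omega), hR₀p _ (by omega), sub_right_comm, ← hSp]
        refine congrArg p ?_
        push_cast
        ring
  obtain ⟨B, hB, R, hR, hRz, hRp⟩ := key (k - 1)
  refine ⟨B, hB, R, hR, hRz, fun n hn => ?_⟩
  rw [hRp n hn]
  apply eq_of_dvd_sub hp
  rw [show (((k - 1 : ℕ) : ℤ) + 1) = k by omega]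
  exact ⟨-B₀, by ring⟩

end Gluing

/-! ### Automorphisms that exchange well-separated blocks -/

section SwapRules

/-- A rule for exchanging two blocks: a block at the positions in `[s, t)` is replaced by the other
one whenever the sequence satisfies a condition on the positions in `[lo, hi)`. Two occurrences
are so far apart that they do not interfere. -/
structure SwapRule (A : Type*) where
  occ : Bool → (ℤ → A) → Prop
  block : Bool → ℤ → A
  lo : ℤ
  s : ℤ
  t : ℤ
  hi : ℤ
  lo_le : lo ≤ s
  s_lt : s < t
  le_hi : t ≤ hi
  eq_block : ∀ b q, occ b q → ∀ n, s ≤ n → n < t → q n = block b n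
  occ_congr : ∀ b q q', occ b q → (∀ n, lo ≤ n → n < hi → q' n = q n) → occ b q'
  occ_replace : ∀ b q q', occ b q → (∀ n, lo ≤ n → n < s → q' n = q n) →
    (∀ n, t ≤ n → n < hi → q' n = q n) → (∀ n, s ≤ n → n < t → q' n = block (!b) n) → occ (!b) q'
  occ_false : ∀ q, occ true q → ¬ occ false q
  -- The block of each of two occurrences misses the window of the other; the windows themselves may
  -- overlap.
  sep : ∀ (q : ℤ → A) (i j : ℤ) (b b' : Bool), occ b (fun n => q (i + n)) →
    occ b' (fun n => q (j + n)) → i < j → t + i ≤ lo + j ∧ hi + i ≤ s + j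

namespace SwapRule

variable {A : Type*} (r : SwapRule A)

/-- The block `b` occurs in `q` at `j`. -/
def OccAt (b : Bool) (q : ℤ → A) (j : ℤ) : Prop := r.occ b fun n => q (j + n)

open Classical in
/-- Exchange the blocks at all occurrences in `S`. -/
noncomputable def swap (S : Set ℤ) (q : ℤ → A) (n : ℤ) : A :=
  if h : ∃ jb : ℤ × Bool, jb.1 ∈ S ∧ r.OccAt jb.2 q jb.1 ∧ r.s ≤ n - jb.1 ∧ n - jb.1 < r.t
  then r.block (!h.choose.2) (n - h.choose.1) else q n

variable {r}

lemma OccAt.bool_unique {q : ℤ → A} {j : ℤ} {b b' : Bool} (h : r.OccAt b q j)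
    (h' : r.OccAt b' q j) : b = b' := by
  cases b <;> cases b'
  · rfl
  · exact (r.occ_false _ h' h).elim
  · exact (r.occ_false _ h h').elim
  · rfl

/-- The block of an occurrence does not meet the window of another one. -/
lemma OccAt.disjoint {q : ℤ → A} {i j : ℤ} {b b' : Bool} (h : r.OccAt b q i)
    (h' : r.OccAt b' q j) (hij : i ≠ j) {n : ℤ} (h1 : r.s ≤ n - i) (h2 : n - i < r.t)
    (h3 : r.lo ≤ n - j) (h4 : n - j < r.hi) : False := by
  rcases lt_or_gt_of_ne hij with hlt | hlt
  · have := r.sep q i j b b' h h' hlt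
    omega
  · have := r.sep q j i b' b h' h hlt
    omega

lemma swap_of_not {S : Set ℤ} {q : ℤ → A} {n : ℤ}
    (h : ∀ j ∈ S, ∀ b, r.OccAt b q j → r.s ≤ n - j → ¬ n - j < r.t) : r.swap S q n = q n := by
  unfold swap
  rw [dif_neg]
  rintro ⟨⟨j, b⟩, h1, h2, h3, h4⟩
  exact h j h1 b h2 h3 h4

/-- The choice made in `swap` is immaterial, since at most one occurrence has a block covering a
given position. -/
lemma swap_of_occAt {S : Set ℤ} {q : ℤ → A} {j n : ℤ} {b : Bool} (hj : j ∈ S)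
    (h : r.OccAt b q j) (h1 : r.s ≤ n - j) (h2 : n - j < r.t) :
    r.swap S q n = r.block (!b) (n - j) := by
  have hlo := r.lo_le
  have hhi := r.le_hi
  have hex : ∃ jb : ℤ × Bool, jb.1 ∈ S ∧ r.OccAt jb.2 q jb.1 ∧ r.s ≤ n - jb.1 ∧ n - jb.1 < r.t :=
    ⟨(j, b), hj, h, h1, h2⟩
  unfold swap
  rw [dif_pos hex]
  obtain ⟨-, h3, h4, h5⟩ := hex.choose_spec
  have e : hex.choose.1 = j := by
    by_contra hne
    exact h3.disjoint h hne h4 h5 (by omega) (by omega)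
  rw [e] at h3 ⊢
  rw [h3.bool_unique h]

lemma OccAt.swap_of_mem {S : Set ℤ} {q : ℤ → A} {j : ℤ} {b : Bool} (hj : j ∈ S)
    (h : r.OccAt b q j) : r.OccAt (!b) (r.swap S q) j := by
  have hlo := r.lo_le
  have hhi := r.le_hi
  have aux : ∀ n, r.lo ≤ n → n < r.hi → ¬ (r.s ≤ n ∧ n < r.t) →
      r.swap S q (j + n) = q (j + n) := by
    intro n h1 h2 h3
    refine swap_of_not fun i _ b' hi' h4 h5 => ?_
    by_cases hij : i = j
    · subst hij
      exact h3 ⟨by omega, by omega⟩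
    · exact hi'.disjoint h hij h4 h5 (by omega) (by omega)
  refine r.occ_replace b _ _ h (fun n h1 h2 => ?_) (fun n h1 h2 => ?_) (fun n h1 h2 => ?_)
  · exact aux n h1 (by have := r.s_lt; omega) (by omega)
  · exact aux n (by have := r.s_lt; omega) h2 (by omega)
  · rw [swap_of_occAt hj h (by omega) (by omega)]
    congr 1
    ring

lemma OccAt.swap_of_notMem {S : Set ℤ} {q : ℤ → A} {j : ℤ} {b : Bool} (hj : j ∉ S)
    (h : r.OccAt b q j) : r.OccAt b (r.swap S q) j := by
  have hlo := r.lo_le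
  have hhi := r.le_hi
  refine r.occ_congr b _ _ h fun n h1 h2 => swap_of_not fun i hi b' hi' h4 h5 => ?_
  refine hi'.disjoint h ?_ h4 h5 (by omega) (by omega)
  rintro rfl
  exact hj hi

/-- Swapping creates no new occurrences: every exchanged block is still an occurrence afterwards, so
separation in the swapped sequence shows that the window of an alleged new one was never altered.
This makes `swap` an involution. -/
lemma occAt_swap_univ_iff {q : ℤ → A} {j : ℤ} {b : Bool} :
    r.OccAt b (r.swap Set.univ q) j ↔ r.OccAt (!b) q j := by
  have hlo := r.lo_le
  have hhi := r.le_hi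
  constructor
  · intro h
    by_contra hcon
    have key : r.OccAt b q j := by
      refine r.occ_congr b _ _ h fun n h1 h2 => (swap_of_not fun i _ b' hi' h4 h5 => ?_).symm
      have hi'' := hi'.swap_of_mem (Set.mem_univ i)
      by_cases hij : i = j
      · subst hij
        rw [h.bool_unique hi'', Bool.not_not] at hcon
        exact hcon hi'
      · exact hi''.disjoint h hij h4 h5 (by omega) (by omega)
    have := h.bool_unique (key.swap_of_mem (Set.mem_univ j))
    simp at this
  · intro h
    simpa using h.swap_of_mem (Set.mem_univ j)

lemma swap_swap (q : ℤ → A) : r.swap Set.univ (r.swap Set.univ q) = q := by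
  funext n
  by_cases h : ∃ j b, r.OccAt b q j ∧ r.s ≤ n - j ∧ n - j < r.t
  · obtain ⟨j, b, h1, h2, h3⟩ := h
    rw [swap_of_occAt (Set.mem_univ j) (h1.swap_of_mem (Set.mem_univ j)) h2 h3,
      Bool.not_not, ← r.eq_block b _ h1 _ h2 h3]
    exact congrArg q (by ring)
  · push Not at h
    rw [swap_of_not, swap_of_not]
    · exact fun j _ b h1 h2 h3 => absurd h3 (not_lt.2 (h j b h1 h2))
    · intro j _ b h1 h2 h3
      rw [occAt_swap_univ_iff] at h1
      exact absurd h3 (not_lt.2 (h j _ h1 h2))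

lemma swap_shift (q : ℤ → A) (a : ℤ) :
    r.swap Set.univ (fun n => q (a + n)) = fun n => r.swap Set.univ q (a + n) := by
  have e : ∀ b j, r.OccAt b (fun n => q (a + n)) j ↔ r.OccAt b q (a + j) := by
    intro b j
    unfold OccAt
    simp only [add_assoc]
  funext n
  by_cases h : ∃ j b, r.OccAt b (fun n => q (a + n)) j ∧ r.s ≤ n - j ∧ n - j < r.t
  · obtain ⟨j, b, h1, h2, h3⟩ := h
    rw [swap_of_occAt (Set.mem_univ j) h1 h2 h3,
      swap_of_occAt (Set.mem_univ (a + j)) ((e b j).1 h1) (by omega) (by omega)]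
    congr 1
    ring
  · push Not at h
    rw [swap_of_not, swap_of_not]
    · intro j _ b h1 h2 h3
      refine absurd h3 (not_lt.2 ?_)
      have := h (j - a) b ((e _ _).2 (by rwa [add_sub_cancel])) (by omega)
      omega
    · exact fun j _ b h1 h2 h3 => absurd h3 (not_lt.2 (h j b h1 h2))

/-- Locality of the exchange, which yields continuity: only occurrences whose block covers `n`
matter, and their windows lie in a bounded interval around `n`. -/
lemma swap_congr_window {q q' : ℤ → A} {n : ℤ}
    (h : ∀ m, n - r.t + r.lo ≤ m → m ≤ n - r.s + r.hi → q' m = q m) :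
    r.swap Set.univ q' n = r.swap Set.univ q n := by
  have hlo := r.lo_le
  have hhi := r.le_hi
  by_cases hex : ∃ j b, r.OccAt b q j ∧ r.s ≤ n - j ∧ n - j < r.t
  · obtain ⟨j, b, h1, h2, h3⟩ := hex
    rw [swap_of_occAt (Set.mem_univ j) h1 h2 h3,
      swap_of_occAt (Set.mem_univ j) (b := b) _ h2 h3]
    exact r.occ_congr b _ _ h1 fun m h4 h5 => h _ (by omega) (by omega)
  · push Not at hex
    have hst := r.s_lt
    rw [swap_of_not, swap_of_not, h n (by omega) (by omega)]
    · exact fun j _ b h1 h2 h3 => absurd h3 (not_lt.2 (hex j b h1 h2))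
    · intro j _ b h1 h2 h3
      refine absurd h3 (not_lt.2 (hex j b ?_ h2))
      exact r.occ_congr b _ _ h1 fun m h4 h5 => (h _ (by omega) (by omega)).symm

lemma swap_eq_of_forall_mem {S T : Set ℤ} (hST : S ⊆ T) {q : ℤ → A} {n : ℤ}
    (h : ∀ j ∈ T, r.s ≤ n - j → n - j < r.t → j ∈ S) :
    r.swap T q n = r.swap S q n := by
  by_cases hex : ∃ j ∈ T, ∃ b, r.OccAt b q j ∧ r.s ≤ n - j ∧ n - j < r.t
  · obtain ⟨j, h0, b, h1, h2, h3⟩ := hex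
    rw [swap_of_occAt h0 h1 h2 h3, swap_of_occAt (h j h0 h2 h3) h1 h2 h3]
  · push Not at hex
    rw [swap_of_not, swap_of_not]
    · exact fun j h0 b h1 h2 h3 => absurd h3 (not_lt.2 (hex j (hST h0) b h1 h2))
    · exact fun j h0 b h1 h2 h3 => absurd h3 (not_lt.2 (hex j h0 b h1 h2))

variable [TopologicalSpace A] {X : Subshift A ℤ}

/-- Exchanging blocks preserves `X` if a single replacement does. -/
lemma swap_mem
    (hX : ∀ q ∈ X.carrier, ∀ b, r.occ b q → ∀ q' : ℤ → A, (∀ n < r.s, q' n = q n) →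
      (∀ n, r.t ≤ n → q' n = q n) → (∀ n, r.s ≤ n → n < r.t → q' n = r.block (!b) n) →
      q' ∈ X.carrier)
    {q : ℤ → A} (hq : q ∈ X.carrier) : r.swap Set.univ q ∈ X.carrier := by
  classical
  -- Finitely many exchanges can be made one at a time, since each leaves the other occurrences
  -- intact. Infinitely many are a limit of these.
  have fin : ∀ S : Finset ℤ, r.swap S q ∈ X.carrier := by
    intro S
    induction S using Finset.induction_on with
    | empty =>
      convert hq using 1
      funext n
      exact swap_of_not (by simp)
    | insert j S hj ih =>
      have hout : ∀ n, ¬ (r.s ≤ n - j ∧ n - j < r.t) →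
          r.swap (insert j S : Finset ℤ) q n = r.swap S q n := by
        intro n hn
        refine swap_eq_of_forall_mem (by simp) fun i hi h1 h2 => ?_
        rw [Finset.coe_insert, Set.mem_insert_iff] at hi
        rcases hi with rfl | hi
        · exact absurd ⟨h1, h2⟩ hn
        · exact hi
      by_cases h : ∃ b, r.OccAt b q j
      · obtain ⟨b, hb⟩ := h
        have := hX _ (shift_mem ih j) b (hb.swap_of_notMem (by simpa using hj))
          (fun n => r.swap (insert j S : Finset ℤ) q (j + n))
          (fun n hn => hout _ (by omega)) (fun n hn => hout _ (by omega))
          (fun n h1 h2 => by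
            rw [swap_of_occAt (by simp) hb (by omega) (by omega)]
            congr 1
            ring)
        convert shift_mem this (-j) using 2
        simp
      · push Not at h
        convert ih using 1
        funext n
        by_cases hn : r.s ≤ n - j ∧ n - j < r.t
        · by_cases hex : ∃ i ∈ S, ∃ b, r.OccAt b q i ∧ r.s ≤ n - i ∧ n - i < r.t
          · obtain ⟨i, hi, b, h1, h2, h3⟩ := hex
            rw [swap_of_occAt (by simp [hi]) h1 h2 h3, swap_of_occAt (by simpa using hi) h1 h2 h3]
          · push Not at hex
            rw [swap_of_not, swap_of_not]
            · exact fun i hi b h1 h2 h3 => absurd h3 (not_lt.2 (hex i hi b h1 h2))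
            · intro i hi b h1 h2 h3
              rw [Finset.coe_insert, Set.mem_insert_iff] at hi
              rcases hi with rfl | hi
              · exact h b h1
              · exact absurd h3 (not_lt.2 (hex i hi b h1 h2))
        · exact hout n hn
  apply mem_of_forall_window
  intro N
  -- These are all the positions whose block can meet the window `[-N, N)`.
  refine ⟨_, fin (Finset.Icc (-N - r.t) (N - r.s)), fun n h1 h2 => ?_⟩
  refine (swap_eq_of_forall_mem (Set.subset_univ _) fun j _ h3 h4 => ?_).symm
  simp only [Finset.coe_Icc, Set.mem_Icc]
  omega

variable [DiscreteTopology A]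

/-- A swap rule which preserves `X` induces an automorphism of `X`. -/
lemma exists_aut (r : SwapRule A)
    (hX : ∀ q ∈ X.carrier, ∀ b, r.occ b q → ∀ q' : ℤ → A, (∀ n < r.s, q' n = q n) →
      (∀ n, r.t ≤ n → q' n = q n) → (∀ n, r.s ≤ n → n < r.t → q' n = r.block (!b) n) →
      q' ∈ X.carrier) :
    ∃ g : X.Aut, ∀ q : X.carrier, (g.1 q).1 = r.swap Set.univ q.1 := by
  have hcont : Continuous fun q : X.carrier => (⟨_, swap_mem hX q.2⟩ : X.carrier) := by
    refine Continuous.subtype_mk (continuous_pi fun n => ?_) _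
    refine IsLocallyConstant.continuous ((IsLocallyConstant.iff_eventually_eq _).2 fun q => ?_)
    have : ∀ᶠ q' in nhds q, ∀ m ∈ Set.Icc (n - r.t + r.lo) (n - r.s + r.hi), q'.1 m = q.1 m := by
      rw [Filter.eventually_all_finite (Set.finite_Icc _ _)]
      intro m _
      have hc : Continuous fun q' : X.carrier => q'.1 m :=
        (continuous_apply m).comp continuous_subtype_val
      have := hc.tendsto q
      rwa [nhds_discrete (α := A), Filter.tendsto_pure] at this
    filter_upwards [this] with q' hq'
    exact swap_congr_window fun m h1 h2 => hq' m ⟨h1, h2⟩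
  let f : X.carrier ≃ₜ X.carrier :=
    { toFun := fun q => ⟨_, swap_mem hX q.2⟩
      invFun := fun q => ⟨_, swap_mem hX q.2⟩
      left_inv := fun q => Subtype.ext (swap_swap q.1)
      right_inv := fun q => Subtype.ext (swap_swap q.1)
      continuous_toFun := hcont
      continuous_invFun := hcont }
  refine ⟨⟨f, Subgroup.mem_centralizer_singleton_iff.2 ?_⟩, fun q => rfl⟩
  ext q n
  exact congrFun (swap_shift q.1 1) n

end SwapRule
end SwapRules

/-! ### Automorphisms as sliding block codes -/

section Radius

variable {A : Type*} [TopologicalSpace A] [Finite A] [DiscreteTopology A] {X : Subshift A ℤ}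

/-- Automorphisms are sliding block codes. -/
lemma Aut.exists_radius (g : X.Aut) : ∃ r : ℕ, ∀ (q q' : X.carrier) (n : ℤ),
    (∀ m, n - r ≤ m → m ≤ n + r → q.1 m = q'.1 m) → (g.1 q).1 n = (g.1 q').1 n := by
  have : CompactSpace X.carrier := isCompact_iff_compactSpace.mp X.isClosed.isCompact
  have coord : ∀ m : ℤ, Continuous fun q : X.carrier => q.1 m := fun m =>
    (continuous_apply m).comp continuous_subtype_val
  suffices H : ∃ r : ℕ, ∀ q q' : X.carrier, (∀ m : ℤ, -r ≤ m → m ≤ r → q.1 m = q'.1 m) →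
      (g.1 q).1 0 = (g.1 q').1 0 by
    obtain ⟨r, hr⟩ := H
    refine ⟨r, fun q q' n h => ?_⟩
    have := hr (X.sigma n q) (X.sigma n q') fun m h1 h2 => h _ (by omega) (by omega)
    simpa [Aut.sigma_comm] using this
  by_contra! hcon
  -- Pairs that agree on `[-r, r]` although their images differ at `0`. By compactness these nested
  -- sets would share a pair, whose two members are equal.
  let K : ℕ → Set (X.carrier × X.carrier) := fun r =>
    {a | (g.1 a.1).1 0 ≠ (g.1 a.2).1 0} ∩ ⋂ m ∈ Set.Icc (-r : ℤ) r, {a | a.1.1 m = a.2.1 m}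
  have hK : ∀ r, IsClosed (K r) := by
    intro r
    refine IsClosed.inter ?_ (isClosed_biInter fun m _ => isClosed_eq
      ((coord m).comp continuous_fst) ((coord m).comp continuous_snd))
    have hc : Continuous fun a : X.carrier × X.carrier => ((g.1 a.1).1 0, (g.1 a.2).1 0) :=
      ((coord 0).comp (g.1.continuous.comp continuous_fst)).prodMk
        ((coord 0).comp (g.1.continuous.comp continuous_snd))
    exact (isClosed_discrete {a : A × A | a.1 ≠ a.2}).preimage hc
  obtain ⟨⟨q, q'⟩, hqq⟩ := IsCompact.nonempty_iInter_of_sequence_nonempty_isCompact_isClosed K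
    (fun r => Set.inter_subset_inter_right _ (Set.biInter_mono (fun m hm => by
      simp only [Set.mem_Icc] at hm ⊢
      push_cast
      omega) fun _ _ => le_rfl))
    (fun r => by
      obtain ⟨q, q', h, hne⟩ := hcon r
      refine ⟨(q, q'), hne, ?_⟩
      simpa using h)
    (hK 0).isCompact hK
  simp only [Set.mem_iInter] at hqq
  refine (hqq 0).1 ?_
  have : q = q' := by
    ext m
    have := (hqq m.natAbs).2
    simp only [Set.mem_iInter] at this
    exact this m (by simp only [Set.mem_Icc]; omega)
  rw [this]

end Radius

/-! ### The excursion rule and its separation property -/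

section ExcursionRule

variable {A : Type*}

lemma eq_sub_of_eq_on_period {p : ℤ → A} {k : ℕ} (hk : 0 < k) (hp : ∀ n, p n = p (n - k))
    (a t : ℤ) (h : ∀ n, a ≤ n → n < a + k → p n = p (n - t)) (n : ℤ) : p n = p (n - t) := by
  have hk' : (0 : ℤ) < k := by exact_mod_cast hk
  have h1 := Int.emod_nonneg (n - a) hk'.ne'
  have h2 := Int.emod_lt_of_pos (n - a) hk'
  have h3 := Int.dvd_self_sub_emod (x := n - a) (m := k)
  rw [eq_of_dvd_sub hp (m := n) (n := a + (n - a) % k) (by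
      rwa [show n - (a + (n - a) % k) = n - a - (n - a) % k by ring]),
    h _ (by omega) (by omega)]
  apply eq_of_dvd_sub hp
  rw [show a + (n - a) % k - t - (n - t) = -(n - a - (n - a) % k) by ring, dvd_neg]
  exact h3

/-- The pattern of the excursion rule: a long run of `p` interrupted by an excursion, or not, and
followed by a continuation of the run, which then breaks in a way that is not the beginning
of `z`. -/
def ExcursionPattern (p b z : ℤ → A) (k n₀ M D : ℕ) (q : ℤ → A) : Prop :=
  (∀ n : ℤ, k - M ≤ n → n < D → q n = b n) ∧
    ∃ β : ℤ, D ≤ β ∧ β < D + k ∧ (∀ n : ℤ, D ≤ n → n < β → q n = p n) ∧ q β ≠ p β ∧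
      ∃ m : ℤ, 0 ≤ m ∧ m < n₀ ∧ q (β - k + m) ≠ z m

/-- The rule that inserts the excursion `R` from the periodic sequence `p` in front of the end of a
run of `p`, unless the run ends like the left periodic sequence `z`. -/
def excursionRule (p z R : ℤ → A) (k n₀ B c M : ℕ) (hk : 0 < k) (hkc : k ≤ c) (hkn : k < n₀)
    (hnB : n₀ ≤ B) (hM : 2 * (B + c + n₀ + 3 * k) ≤ M)
    (hp : ∀ n, p n = p (n - k)) (hmin : ∀ t : ℤ, 0 < t → t < k → ¬ ∀ n, p n = p (n - t))
    (hzp : ∀ n < (k : ℤ), z n = p n) (hzk : z k ≠ z 0) (hRz : ∀ n < (n₀ : ℤ), R n = z n)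
    (hRp : ∀ n, (B : ℤ) ≤ n → R n = p n) : SwapRule A where
  occ b q := ExcursionPattern p (bif b then p else R) z k n₀ M (B + c) q
  block b := bif b then p else R
  lo := k - M
  s := k
  t := B
  hi := B + c + n₀ + k
  lo_le := by omega
  s_lt := by omega
  le_hi := by omega
  eq_block b q h n h1 h2 := h.1 n (by omega) (by omega)
  occ_congr := by
    rintro b q q' ⟨h1, β, h2, h3, h4, h5, m, h6, h7, h8⟩ h
    push_cast at h2 h3
    refine ⟨fun n hn hn' => ?_, β, by omega, by omega, fun n hn hn' => ?_, ?_, m, h6, h7, ?_⟩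
    · rw [h n hn (by push_cast at hn'; omega), h1 n hn hn']
    · rw [h n (by push_cast at hn; omega) (by omega), h4 n hn hn']
    · rwa [h β (by omega) (by omega)]
    · rwa [h _ (by omega) (by omega)]
  occ_replace := by
    rintro b q q' ⟨h1, β, h2, h3, h4, h5, m, h6, h7, h8⟩ ha hb hc
    push_cast at h2 h3
    refine ⟨fun n hn hn' => ?_, β, by omega, by omega, fun n hn hn' => ?_, ?_, m, h6, h7, ?_⟩
    · push_cast at hn'
      rcases lt_or_ge n (k : ℤ) with hlt | hge
      · rw [ha n hn hlt, h1 n hn (by omega)]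
        cases b <;> simp [hRz n (by omega), hzp n hlt]
      · rcases lt_or_ge n (B : ℤ) with hlt' | hge'
        · exact hc n hge hlt'
        · rw [hb n hge' (by omega), h1 n hn (by omega)]
          cases b <;> simp [hRp n hge']
    · rw [hb n (by push_cast at hn; omega) (by omega), h4 n hn hn']
    · rwa [hb β (by omega) (by omega)]
    -- The comparison with `z` begins at `β - k`, which is at least `B` because `k ≤ c`; the
    -- replaced block does not reach it.
    · rwa [hb _ (by omega) (by omega)]
  occ_false := by
    rintro q ⟨h1, -⟩ ⟨h2, -⟩
    have h3 := h1 k (by omega) (by push_cast; omega)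
    rw [h2 k (by omega) (by push_cast; omega)] at h3
    simp only [cond_true, cond_false] at h3
    rw [hRz k (by omega), hp, sub_self, ← hzp 0 (by omega)] at h3
    exact hzk h3
  sep := by
    rintro q i j b b' ⟨h1, β, h2, h3, h4, h5, m, h6, h7, h8⟩ ⟨h1', β', h2', h3', h4', h5', -⟩ hij
    push_cast at h1 h2 h3 h4 h1' h2' h3' h4'
    by_contra hcon
    -- As `M` is large, a failure of either inequality means that the run preceding the later block
    -- starts before the earlier block ends.
    have hji : j + k - M < i + B := by omega
    -- the run of `p` around an occurrence
    have run : ∀ {i β : ℤ} {b : Bool},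
        (∀ n : ℤ, k - M ≤ n → n < B + c → q (i + n) = (bif b then p else R) n) →
        (∀ n : ℤ, (B : ℤ) + c ≤ n → n < β → q (i + n) = p n) →
        (∀ n : ℤ, k - M ≤ n → n < k → q (i + n) = p n) ∧
        (∀ n, (B : ℤ) ≤ n → n < β → q (i + n) = p n) := by
      intro i β b h1 h4
      refine ⟨fun n hn hn' => ?_, fun n hn hn' => ?_⟩
      · rw [h1 n hn (by omega)]
        cases b <;> simp [hRz n (by omega), hzp n hn']
      · rcases lt_or_ge n ((B : ℤ) + c) with hlt | hge
        · rw [h1 n (by omega) hlt]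
          cases b <;> simp [hRp n hn]
        · exact h4 n hge hn'
    obtain ⟨l1, r1⟩ := run h1 h4
    obtain ⟨l2, r2⟩ := run h1' h4'
    -- the breaks
    have brk : ∀ {i β : ℤ}, (∀ n, (B : ℤ) ≤ n → n < β → q (i + n) = p n) →
        (B : ℤ) + c ≤ β → q (i + β) ≠ p β → q (i + β) ≠ q (i + β - k) := by
      intro i β r h h' e
      rw [add_sub_assoc, r (β - k) (by omega) (by omega), ← hp] at e
      exact h' e
    have e1 := brk r1 h2 h5
    have e2 := brk r2 h2' h5'
    have out : ∀ {i : ℤ}, (∀ n : ℤ, k - M ≤ n → n < B + c → q (i + n) = R n) →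
        q (i + k) ≠ q (i + k - k) := by
      intro i h e
      rw [add_sub_cancel_right, h k (by omega) (by omega), hRz k (by omega)] at e
      have := h 0 (by omega) (by omega)
      rw [add_zero] at this
      rw [this, hRz 0 (by omega)] at e
      exact hzk e
    have per : ∀ {i lo hi : ℤ}, (∀ n, lo ≤ n → n < hi → q (i + n) = p n) →
        ∀ n, i + lo + k ≤ n → n < i + hi → q n = q (n - k) := by
      intro i lo hi h n hn hn'
      have h1 := h (n - i) (by omega) (by omega)
      have h2 := h (n - i - k) (by omega) (by omega)
      rw [← hp, ← h1] at h2
      rw [show i + (n - i) = n by ring, show i + (n - i - k) = n - k by ring] at h2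
      exact h2.symm
    -- The final break at `i + β` cannot lie inside the run that precedes the block at `j`.
    have c1 : j + k ≤ i + β := by
      by_contra hlt
      exact e1 (per l2 _ (by omega) (by omega))
    cases b with
    | false =>
      -- An excursion at `i` breaks the period at `i + k`, inside the run preceding the block at
      -- `j`.
      exact out h1 (per l2 _ (by omega) (by omega))
    | true =>
      have full1 : ∀ n : ℤ, k - M ≤ n → n < β → q (i + n) = p n := by
        intro n hn hn'
        rcases lt_or_ge n ((B : ℤ) + c) with hlt | hge
        · exact h1 n hn hlt
        · exact h4 n hge hn'
      cases b' with
      | false =>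
        -- The break that opens the excursion at `j` must be the one ending the run at `i`. That run
        -- would then end like `z`, which the pattern at `i` forbids.
        have c2 : j + k = i + β := by
          by_contra hne
          exact out h1' (per full1 _ (by omega) (by omega))
        refine h8 ?_
        beta_reduce
        rw [show i + (β - k + m) = j + m by omega, h1' m (by omega) (by omega)]
        exact hRz m h7
      | true =>
        have full2 : ∀ n : ℤ, k - M ≤ n → n < β' → q (j + n) = p n := by
          intro n hn hn'
          rcases lt_or_ge n ((B : ℤ) + c) with hlt | hge
          · exact h1' n hn hlt
          · exact h4' n hge hn'
        -- Both runs end at the same break, so they overlap in a full period with offset `j - i`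
        -- strictly between `0` and `k`, against minimality of `k`.
        have c2 : i + β = j + β' := by
          rcases lt_trichotomy (i + β) (j + β') with hlt | heq | hgt
          · exact (e1 (per full2 _ (by omega) hlt)).elim
          · exact heq
          · exact (e2 (per full1 _ (by omega) hgt)).elim
        refine hmin (j - i) (by omega) (by omega) ?_
        refine eq_sub_of_eq_on_period hk hp (β - k) _ fun n hn hn' => ?_
        rw [← full1 n (by omega) (by omega), ← full2 _ (by omega) (by omega)]
        congr 1
        ring

end ExcursionRule

/-! ### Left tails and continuity of the action on `Q_k` -/

section LeftTails

variable {A : Type*}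

lemma isLeftPeriodicUpTo_congr {x y : ℤ → A} {k : ℕ} {N : ℤ} (h : ∀ n ≤ N, x n = y n) :
    IsLeftPeriodicUpTo x k N ↔ IsLeftPeriodicUpTo y k N := by
  have e : {j : ℕ | 0 < j ∧ (∀ n < N, x n = x (n - j)) ∧ x N ≠ x (N - j)} =
      {j : ℕ | 0 < j ∧ (∀ n < N, y n = y (n - j)) ∧ y N ≠ y (N - j)} := by
    ext j
    simp only [Set.mem_ofPred_eq]
    rw [h N le_rfl, h (N - j) (by omega)]
    refine and_congr_right fun _ => and_congr_left fun _ => forall₂_congr fun n hn => ?_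
    rw [h n hn.le, h (n - j) (by omega)]
  rw [IsLeftPeriodicUpTo, e]
  rfl

/-- Two sequences with left period `k` that agree on some left tail agree as long as both have
the period. -/
lemma eq_of_eq_tail {x y : ℤ → A} {k : ℕ} (hk : 0 < k) {M N : ℤ}
    (hx : ∀ n < N, x n = x (n - k)) (hy : ∀ n < N, y n = y (n - k))
    (h : ∀ n < M, x n = y n) : ∀ n < N, x n = y n := by
  intro n hn
  obtain ⟨t, ht⟩ : ∃ t : ℕ, n - t * k < M := by
    refine ⟨(n - M).toNat + 1, ?_⟩
    have h4 := Int.self_le_toNat (n - M)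
    have h5 : (1 : ℤ) ≤ k := by exact_mod_cast hk
    push_cast
    nlinarith
  rw [sub_mul_of_period hx t n hn, h _ ht, ← sub_mul_of_period hy t n hn]

variable [TopologicalSpace A] {X : Subshift A ℤ}

lemma Q.period {k : ℕ} (q : X.Q k) : ∀ n < (k : ℤ), q.1.1 n = q.1.1 (n - k) := q.2.1.2.1

lemma Q.break {k : ℕ} (q : X.Q k) : q.1.1 k ≠ q.1.1 0 := by
  have := q.2.1.2.2
  rwa [sub_self] at this

variable [Finite A] [DiscreteTopology A]

lemma smul_apply {k : ℕ} (g : X.Aut) (q : X.Q k) (n : ℤ) :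
    (g • q).1.1 n = (g.1 q.1).1 (cocycle g q + n) := rfl

/-- If a shift of `g q` is in `Q_k`, it is `g • q`. -/
lemma smul_eq_of_mem {k : ℕ} (g : X.Aut) (q : X.Q k) {i : ℤ} (hi : X.sigma i (g.1 q.1) ∈ X.Q k) :
    (g • q).1 = X.sigma i (g.1 q.1) := by
  rw [cocycle_unique g q hi]
  rfl

/-- The action of an automorphism on `Q_k` is continuous, uniformly on left tails. -/
lemma Aut.smul_continuous (g : X.Aut) {k : ℕ} (z : X.Q k) (L : ℤ) :
    ∃ n₀ : ℕ, ∀ q : X.Q k, (∀ n < (n₀ : ℤ), q.1.1 n = z.1.1 n) →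
      ∀ n < L, (g • q).1.1 n = (g • z).1.1 n := by
  obtain ⟨r, hr⟩ := Aut.exists_radius g
  -- Besides the coordinates below `L`, those up to `k` are controlled: they contain the break, so
  -- the same shift recentres both images.
  refine ⟨(r + cocycle g z + L + k + 1).natAbs + (r + cocycle g z + k + 1).natAbs,
    fun q hq n hn => ?_⟩
  have key : ∀ n : ℤ, n < L ∨ n ≤ k →
      (X.sigma (cocycle g z) (g.1 q.1)).1 n = (g • z).1.1 n := by
    intro n hn
    rw [sigma_apply, smul_apply]
    exact hr _ _ _ fun m _ hm => hq m (by omega)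
  have hmem : X.sigma (cocycle g z) (g.1 q.1) ∈ X.Q k :=
    (isLeftPeriodicUpTo_congr fun n hn => key n (Or.inr hn)).2 (g • z).2
  rw [smul_eq_of_mem g q hmem]
  exact key n (Or.inl hn)

/-- Automorphisms map the fiber of a periodic orbit to the fiber of its image. -/
lemma Aut.smul_mem_fiber (g : X.Aut) {k : ℕ} {x : X.carrier} (hx : x ∈ X.Per k) {q : X.Q k}
    (hq : q ∈ X.fiber k x) : g • q ∈ X.fiber k (g.1 x) := by
  obtain ⟨i, hi⟩ := hq
  obtain ⟨M, hM⟩ := Aut.left_tail g (x := q.1) (y := X.sigma (-i) x) (N := k) (fun n hn => by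
    rw [hi n hn, sigma_apply]; exact congrArg x.1 (by ring))
  refine ⟨i - cocycle g q, eq_of_eq_tail (y := fun n => (g.1 x).1 (n - (i - cocycle g q)))
    hx.1.1 (Q.period _) (M := M - cocycle g q) (fun n _ => ?_) fun n hn => ?_⟩
  · rw [(Aut.mem_Per g hx).1.2]
    exact congrArg (g.1 x).1 (by ring)
  · rw [smul_apply, hM _ (by omega), Aut.sigma_comm, sigma_apply]
    exact congrArg (g.1 x).1 (by ring)

end LeftTails

/-! ### Moving the complement of a neighbourhood into it -/

section Contraction

variable {A : Type*} [TopologicalSpace A] {X : Subshift A ℤ}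

/-- Replacing a stretch of `p` by an excursion, or vice versa, preserves `X`. -/
lemma excursion_replace_mem {p R : ℤ → A} {k B c : ℕ} (hpX : p ∈ X.carrier) (hRX : R ∈ X.carrier)
    (hc : ∀ i, X.IsSynchronizingWord (wordAt p i c))
    (hRk : ∀ n < (k : ℤ), R n = p n) (hRp : ∀ n, (B : ℤ) ≤ n → R n = p n) (hkB : k ≤ B)
    {q q' : ℤ → A} (hq : q ∈ X.carrier) (b : Bool)
    (hqb : ∀ n : ℤ, k - c ≤ n → n < B + c → q n = (bif b then p else R) n)
    (h1 : ∀ n < (k : ℤ), q' n = q n) (h2 : ∀ n, (B : ℤ) ≤ n → q' n = q n)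
    (h3 : ∀ n, (k : ℤ) ≤ n → n < B → q' n = (bif !b then p else R) n) : q' ∈ X.carrier := by
  have hblock : ∀ b : Bool, (bif b then p else R) ∈ X.carrier := by
    rintro (_ | _)
    · exact hRX
    · exact hpX
  have hbk : ∀ b : Bool, ∀ n < (k : ℤ), (bif b then p else R) n = p n := by
    rintro (_ | _) n hn
    · exact hRk n hn
    · rfl
  have hbB : ∀ b : Bool, ∀ n, (B : ℤ) ≤ n → (bif b then p else R) n = p n := by
    rintro (_ | _) n hn
    · exact hRp n hn
    · rfl
  -- The new block is glued to `q` on the left along `[k - c, k)`, and then on the right along `[B,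
  -- B + c)`; both blocks read `p` there.
  have hq₁ : (fun n => if n < (k : ℤ) then q n else (bif !b then p else R) n) ∈ X.carrier := by
    refine glue_periodic hc hq (hblock (!b)) (k - c) 0 ?_ ?_ ?_
    · intro n hn
      rw [if_pos (by omega)]
    · intro n hn
      split_ifs with h
      · rw [hqb n hn (by omega), hbk _ n h, hbk _ n h]
      · rfl
    · intro n hn hn'
      rw [if_pos (by omega), hqb n hn (by omega), hbk _ n (by omega), sub_zero]
  refine glue_periodic hc hq₁ hq B 0 ?_ h2 ?_
  · intro n hn
    split_ifs with h
    · exact h1 n h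
    · rcases lt_or_ge n (B : ℤ) with hlt | hge
      · exact h3 n (by omega) hlt
      · rw [h2 n hge, hqb n (by omega) hn, hbB _ n hge, hbB _ n hge]
  · intro n hn hn'
    rw [h2 n hn, hqb n (by omega) hn', hbB _ n hn, sub_zero]

variable [Finite A] [DiscreteTopology A]

/-- Over a synchronizing periodic orbit, the complement of any small neighbourhood of a point of
the fiber can be moved into this neighbourhood. -/
lemma exists_contraction (htrans : X.IsTransitive) {k : ℕ} {ξ : X.carrier} (hξ : ξ ∈ X.Per k)
    (hs : X.IsSynchronizing ξ) {z : X.Q k} (hz : z ∈ X.fiber k ξ) {n₀ : ℕ} (hn₀ : k < n₀) :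
    ∃ g : X.Aut, (∀ c : X.PerOrbits k, g • c = c) ∧ ∀ q ∈ X.fiber k ξ,
      (∃ m : ℤ, 0 ≤ m ∧ m < n₀ ∧ q.1.1 m ≠ z.1.1 m) →
        ∀ m < (n₀ : ℤ), (g • q).1.1 m = z.1.1 m := by
  have hk : 0 < k := hξ.1.1
  obtain ⟨i₀, hi₀⟩ := hz
  set p : ℤ → A := fun n => ξ.1 (n - i₀) with hpdef
  have hpX : p ∈ X.carrier := shift_mem' ξ.2 i₀
  have hp : ∀ n, p n = p (n - k) := by
    intro n
    simp only [hpdef]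
    rw [hξ.1.2]
    exact congrArg ξ.1 (by ring)
  have hmin : ∀ t : ℤ, 0 < t → t < k → ¬ ∀ n, p n = p (n - t) := by
    intro t ht htk h
    have hmem : t.toNat ∈ {j : ℕ | 0 < j ∧ ∀ n : ℤ, ξ.1 n = ξ.1 (n - j)} := by
      refine ⟨by omega, fun n => ?_⟩
      have := h (n + i₀)
      simp only [hpdef] at this
      rw [add_sub_cancel_right] at this
      rw [Int.toNat_of_nonneg ht.le, this]
      exact congrArg ξ.1 (by ring)
    have := hξ.2 hmem
    omega
  obtain ⟨c₀, hc₀⟩ := hs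
  set c := max c₀ k with hcdef
  have hc : ∀ i, X.IsSynchronizingWord (wordAt p i c) := by
    intro i
    refine hc₀ _ (by simp [hcdef]) ⟨i - i₀, ?_⟩
    rw [occursAt_wordAt_iff]
    intro j _
    exact congrArg ξ.1 (by ring)
  have hzk : z.1.1 k ≠ z.1.1 0 := Q.break z
  obtain ⟨B, hnB, R, hRX, hRz, hRp⟩ := exists_homoclinic htrans hk hpX hp hc z.1.2 hi₀ n₀ hn₀.le
  set M := 2 * (B + c + n₀ + 3 * k) with hM
  have hkc : k ≤ c := le_max_right _ _
  have hRk : ∀ n < (k : ℤ), R n = p n := fun n hn => by rw [hRz n (by omega), hi₀ n hn]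
  let r := excursionRule p z.1.1 R k n₀ B c M hk hkc hn₀ hnB le_rfl hp hmin hi₀ hzk hRz hRp
  have hX : ∀ q ∈ X.carrier, ∀ b, r.occ b q → ∀ q' : ℤ → A, (∀ n < r.s, q' n = q n) →
      (∀ n, r.t ≤ n → q' n = q n) → (∀ n, r.s ≤ n → n < r.t → q' n = r.block (!b) n) →
      q' ∈ X.carrier := by
    intro q hq b hb q' h1 h2 h3
    exact excursion_replace_mem hpX hRX hc hRk hRp (by omega) hq b
      (fun n h4 h5 => hb.1 n (by omega) (by push_cast; omega)) h1 h2 h3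
  obtain ⟨g, hg⟩ := SwapRule.exists_aut r hX
  -- every occurrence of the pattern involves a break of the period
  have hbreak : ∀ (q : ℤ → A) (j : ℤ) (b : Bool), r.OccAt b q j →
      ∃ β : ℤ, B + c ≤ β ∧ β < B + c + k ∧ q (j + β) ≠ q (j + β - k) := by
    rintro q j b ⟨h1, β, h2, h3, h4, h5, -⟩
    push_cast at h1 h2 h3 h4
    refine ⟨β, h2, h3, fun e => h5 ?_⟩
    beta_reduce
    have : q (j + (β - k)) = p (β - k) := by
      rcases lt_or_ge (β - k) ((B : ℤ) + c) with hlt | hge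
      · rw [h1 (β - k) (by omega) hlt]
        cases b <;> simp [hRp (β - k) (by omega)]
      · exact h4 _ hge (by omega)
    rw [e, add_sub_assoc, this, ← hp]
  refine ⟨g, fun cl => ?_, ?_⟩
  · induction cl using Quotient.inductionOn with
    | h y =>
      refine Quotient.sound ⟨0, ?_⟩
      rw [sigma_zero]
      ext n
      change (g.1 y.1).1 n = _
      rw [hg, SwapRule.swap_of_not]
      intro j _ b hj
      obtain ⟨β, -, -, hβ⟩ := hbreak _ _ _ hj
      exact (hβ (y.2.1.2 _)).elim
  · rintro q ⟨i, hi⟩ ⟨m, hm0, hm1, hm⟩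
    have hper := Q.period q
    -- The range for `β` is a full residue system modulo `k`, so it contains the value for which the
    -- left tail of `q` is in phase with `p` placed at `k - β`.
    obtain ⟨β, hβ1, hβ2, hβk⟩ : ∃ β : ℤ, B + c ≤ β ∧ β < B + c + k ∧
        (k : ℤ) ∣ i - i₀ - (k - β) := by
      have hk' : (0 : ℤ) < k := by exact_mod_cast hk
      have h1 := Int.emod_nonneg (k - (i - i₀) - (B + c)) hk'.ne'
      have h2 := Int.emod_lt_of_pos (k - (i - i₀) - (B + c)) hk'
      refine ⟨B + c + (k - (i - i₀) - (B + c)) % k, by omega, by omega, ?_⟩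
      have h3 := Int.dvd_self_sub_emod (x := k - (i - i₀) - (B + c)) (m := k)
      rw [show i - i₀ - (k - (B + c + (k - (i - i₀) - (B + c)) % k)) =
        -(k - (i - i₀) - (B + c) - (k - (i - i₀) - (B + c)) % k) by ring, dvd_neg]
      exact h3
    set j : ℤ := k - β with hj
    have hqp : ∀ n < (k : ℤ), q.1.1 n = p (n - j) := by
      intro n hn
      rw [hi n hn, show ξ.1 (n - i) = p (n - (i - i₀)) from congrArg ξ.1 (by ring)]
      apply eq_of_dvd_sub hp
      rw [show n - (i - i₀) - (n - j) = -(i - i₀ - j) by ring, dvd_neg]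
      exact hβk
    have hocc : r.OccAt true q.1.1 j := by
      refine ⟨fun n h1 h2 => ?_, β, by push_cast; omega, by push_cast; omega, fun n h1 h2 => ?_,
        fun e => ?_, m, hm0, hm1, ?_⟩
      · push_cast at h2
        beta_reduce
        rw [hqp _ (by omega), add_sub_cancel_left]
        rfl
      · beta_reduce
        rw [hqp _ (by omega), add_sub_cancel_left]
      · beta_reduce at e
        refine Q.break q ?_
        rw [hqp 0 (by omega), show (k : ℤ) = j + β by omega, e, hp]
        exact congrArg p (by omega)
      · beta_reduce
        rwa [show j + (β - k + m) = m by omega]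
    have hleft : ∀ n < (B : ℤ) + c, (g.1 q.1).1 (j + n) = R n := by
      intro n hn
      rw [hg]
      rcases lt_or_ge n (k : ℤ) with hlt | hge
      · rw [SwapRule.swap_of_not, hqp _ (by omega), add_sub_cancel_left, hRk n hlt]
        -- A further block altering the left part would lie far to the left of `j` by separation.
        -- Its own break would then fall where `q` is still periodic.
        intro i' _ b hi' h1 h2
        obtain ⟨β', h3, h4, h5⟩ := hbreak _ _ _ hi'
        have h6 : (k : ℤ) ≤ i' + β' := by
          by_contra hcon
          exact h5 (hper _ (by omega))
        have h7 : i' < j := by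
          change (k : ℤ) ≤ _ at h1
          omega
        have h8 := (r.sep _ _ _ _ _ hi' hocc h7).1
        change (B : ℤ) + i' ≤ k - (M : ℤ) + j at h8
        omega
      · have hocc' := hocc.swap_of_mem (Set.mem_univ j)
        exact hocc'.1 n (by omega) (by push_cast; omega)
    -- The first break of the image is now the one opening the excursion, at `j + k`, so the shift
    -- by `j` recentres it.
    have hmem : X.sigma j (g.1 q.1) ∈ X.Q k := by
      refine (isLeftPeriodicUpTo_congr fun n hn => ?_).2 z.2
      rw [sigma_apply, hleft n (by omega), hRz n (by omega)]
    intro m hm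
    rw [smul_eq_of_mem g q hmem, sigma_apply, hleft m (by omega), hRz m hm]

end Contraction

/-! ### Compression between cylinders and conjugation -/

section Main

lemma occursAt_congr {A : Type*} {w : List A} {x y : ℤ → A} (h : ∀ n < (w.length : ℤ), x n = y n)
    (hx : OccursAt w x 0) : OccursAt w y 0 := fun j hj => by
  rw [← hx j hj, h _ (by omega)]

/-- One period determines the left tail. Hence coordinates in `[0, n₀)` with `k < n₀` also detect
the phase, which varies within a fiber. -/
lemma eq_of_eq_on_nonneg {A : Type*} {x y : ℤ → A} {k : ℕ} (hk : 0 < k)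
    (hx : ∀ n < (k : ℤ), x n = x (n - k)) (hy : ∀ n < (k : ℤ), y n = y (n - k))
    (h : ∀ n : ℤ, 0 ≤ n → n < k → x n = y n) : ∀ n < (k : ℤ), x n = y n := by
  intro n hn
  have hk' : (0 : ℤ) < k := by exact_mod_cast hk
  have h1 := Int.emod_nonneg n hk'.ne'
  have h2 := Int.emod_lt_of_pos n hk'
  have h3 : n / k ≤ 0 := by
    by_contra hcon
    have := (Int.le_ediv_iff_mul_le hk').1 (show 1 ≤ n / (k : ℤ) by omega)
    omega
  have h4 : n = n % k - (-(n / k)).toNat * k := by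
    rw [Int.toNat_of_nonneg (by omega)]
    linarith [Int.emod_add_mul_ediv n k]
  rw [h4, ← sub_mul_of_period hx _ _ h2, ← sub_mul_of_period hy _ _ h2]
  exact h _ h1 h2

variable {A : Type*} [TopologicalSpace A] {X : Subshift A ℤ} [Finite A] [DiscreteTopology A]

/-- The action over a synchronizing periodic orbit is extremely proximal: the complement of a
neighbourhood of `z` can be moved into any given neighbourhood of `y`. -/
lemma exists_compression (htrans : X.IsTransitive) {k : ℕ} {ξ : X.carrier} (hξ : ξ ∈ X.Per k)
    (hs : X.IsSynchronizing ξ) {z y : X.Q k} (hz : z ∈ X.fiber k ξ) (hy : y ∈ X.fiber k ξ)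
    {n₀ : ℕ} (hn₀ : k < n₀) :
    ∃ g : X.Aut, (∀ c : X.PerOrbits k, g • c = c) ∧ ∀ q ∈ X.fiber k ξ,
      (∃ m : ℤ, 0 ≤ m ∧ m < n₀ ∧ q.1.1 m ≠ z.1.1 m) →
        ∀ m < (n₀ : ℤ), (g • q).1.1 m = y.1.1 m := by
  obtain ⟨g, hg, hgz⟩ := exists_contraction htrans hξ hs hz hn₀
  -- The `n₀`-neighbourhoods of `z` and `y` are disjoint or equal. If disjoint, a contraction
  -- towards `y` sends the first one into the second.
  by_cases hzy : ∃ m : ℤ, 0 ≤ m ∧ m < n₀ ∧ z.1.1 m ≠ y.1.1 m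
  · obtain ⟨f, hf, hfy⟩ := exists_contraction htrans hξ hs hy hn₀
    refine ⟨f * g, fun c => by rw [mul_smul, hg, hf], fun q hq hqz => ?_⟩
    have hgq := hgz q hq hqz
    obtain ⟨i, hi⟩ := hz
    obtain ⟨m, h1, h2, h3⟩ := hzy
    rw [mul_smul]
    refine hfy _ ⟨i, fun n hn => ?_⟩ ⟨m, h1, h2, ?_⟩
    · rw [hgq n (by omega), hi n hn]
    · rwa [hgq m h2]
  · push Not at hzy
    refine ⟨g, hg, fun q hq hqz m hm => ?_⟩
    rw [hgz q hq hqz m hm]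
    rcases lt_or_ge m 0 with hneg | hnonneg
    · exact eq_of_eq_on_nonneg hξ.1.1 (Q.period z) (Q.period y)
        (fun n h1 h2 => hzy n h1 (by omega)) m (by omega)
    · exact hzy m hnonneg hm

/-- The compression property over the orbit of a periodic point that is mapped to a synchronizing
point by some automorphism. -/
lemma exists_smul_fiberCylinder_subset (htrans : X.IsTransitive) {k : ℕ} {x : X.carrier}
    (hx : x ∈ X.Per k) {h : X.Aut} (hs : X.IsSynchronizing (h.1 x)) {w u : List A}
    (hw_proper : X.fiberCylinder k x w ≠ X.fiber k x)
    (hu_nonempty : (X.fiberCylinder k x u).Nonempty) :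
    ∃ g : X.Aut, (∀ c : X.PerOrbits k, g • c = c) ∧
      g • X.fiberCylinder k x w ⊆ X.fiberCylinder k x u := by
  obtain ⟨z, hz, hzw⟩ : ∃ z ∈ X.fiber k x, ¬ OccursAt w z.1.1 0 := by
    by_contra! hcon
    exact hw_proper (Set.Subset.antisymm Set.inter_subset_right fun z hz => ⟨hcon z hz, hz⟩)
  obtain ⟨y, hyu, hy⟩ := hu_nonempty
  -- Continuity of `h⁻¹` at `h • z` and `h • y` turns the cylinder conditions for `w` and `u` into
  -- neighbourhoods over the synchronizing orbit.
  obtain ⟨n₁, hn₁⟩ := Aut.smul_continuous h⁻¹ (h • z) w.length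
  obtain ⟨n₂, hn₂⟩ := Aut.smul_continuous h⁻¹ (h • y) u.length
  simp only [inv_smul_smul] at hn₁ hn₂
  obtain ⟨g, hg, hgz⟩ := exists_compression htrans (Aut.mem_Per h hx) hs
    (Aut.smul_mem_fiber h hx hz) (Aut.smul_mem_fiber h hx hy)
    (n₀ := n₁ + n₂ + k + 1) (by omega)
  refine ⟨h⁻¹ * (g * h), fun c => by rw [mul_smul, mul_smul, hg, inv_smul_smul], ?_⟩
  rintro _ ⟨q, ⟨hqw, hq⟩, rfl⟩
  have hhq := Aut.smul_mem_fiber h hx hq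
  -- Otherwise `z` would begin with `w`, as `q` does.
  have hfar : ∃ m : ℤ, 0 ≤ m ∧ m < (n₁ + n₂ + k + 1 : ℕ) ∧ (h • q).1.1 m ≠ (h • z).1.1 m := by
    by_contra! hcon
    refine hzw (occursAt_congr (hn₁ (h • q) fun n hn => ?_) (by rwa [inv_smul_smul]))
    rcases lt_or_ge n 0 with hneg | hnonneg
    · exact eq_of_eq_on_nonneg hx.1.1 (Q.period _) (Q.period _)
        (fun n h1 h2 => hcon n h1 (by push_cast; omega)) n (by omega)
    · exact hcon n hnonneg (by push_cast; omega)
  have hclose := hgz _ hhq hfar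
  have hgq : g • h • q ∈ X.fiber k (h.1 x) := by
    obtain ⟨i, hi⟩ := Aut.smul_mem_fiber h hx hy
    exact ⟨i, fun n hn => by rw [hclose n (by push_cast; omega), hi n hn]⟩
  change (h⁻¹ * (g * h)) • q ∈ _
  rw [mul_smul, mul_smul]
  refine ⟨occursAt_congr (fun n hn => (hn₂ _ (fun n hn => ?_) n hn).symm) hyu, ?_⟩
  · exact hclose n (by push_cast; omega)
  · have := Aut.smul_mem_fiber h⁻¹ (Aut.mem_Per h hx) hgq
    rwa [Aut.inv_apply_self] at this

end Main

end SymbolicDynamics.FullShift.Subshift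

theorem proposition3 {A : Type*} [Finite A] [TopologicalSpace A] [DiscreteTopology A]
    (X : Subshift A ℤ) (htrans : X.IsTransitive) (hsofic : X.IsSofic)
    (k : ℕ) (hleft : ∃ z : X.carrier, Subshift.IsLeftPeriodic z.1 k)
    (x : X.carrier) (hx : x ∈ X.Syn k)
    (w u : List A) (hw : w ∈ X.language) (hu : u ∈ X.language)
    (hw_nonempty : (X.fiberCylinder k x w).Nonempty)
    (hw_proper : X.fiberCylinder k x w ≠ X.fiber k x)
    (hu_nonempty : (X.fiberCylinder k x u).Nonempty)
    (hu_proper : X.fiberCylinder k x u ≠ X.fiber k x) :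
    ∃ g : X.Aut, (∀ c : X.PerOrbits k, g • c = c) ∧
      g • X.fiberCylinder k x w ⊆ X.fiberCylinder k x u := by
  obtain ⟨hper, hs | ⟨h, hs⟩⟩ := hx
  · exact Subshift.exists_smul_fiberCylinder_subset htrans hper (h := 1) hs hw_proper hu_nonempty
  · exact Subshift.exists_smul_fiberCylinder_subset htrans hper hs hw_proper hu_nonempty
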